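/- Let $m,N_1,\dots,N_{m-1}\ge 1$ be integers and $n:=N_1+\dots+N_{m-1}+1$. Divide the first $n-1$ coordinates of $x\in\mathbb R^n$ into consecutive groups $X_1\in\mathbb R^{N_1},\dots,X_{m-1}\in\mathbb R^{N_{m-1}}$; the last coordinate is $x_n$. For $y\in\mathbb R^{N_i}$ let $y^{(i)}\in\mathbb R^n$ be the vector whose $i$-th group of coordinates is $y$ and whose other coordinates are zero. Let $s_1,\dots,s_{m-1}\in(0,1]$, $a_1,\dots,a_{m-1}\ge 0$, $a=a_m>0$, $s_m:=1$, and $$Lu:=\sum_{i=1}^{m-1}a_i(-\Delta_{X_i})^{s_i}u-a\,\partial^2_{x_n}u,$$ where $(-\Delta_{X_i})^{1}u=-\Delta_{X_i}u$ is minus the sum of the second partial derivatives in the coordinates of $X_i$, and for $s_i\in(0,1)$ $$(-\Delta_{X_i})^{s_i}u(x)=c_{N_i,s_i}\int_{\mathbb R^{N_i}}\frac{2u(x)-u(x+y^{(i)})-u(x-y^{(i)})}{|y|^{N_i+2s_i}}\,dy,\qquad c_{N,s}=\frac{2^{2s-1}\,\Gamma(s+\frac N2)}{\pi^{N/2}\,|\Gamma(-s)|}.$$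 Put $s_{\min}:=\min\{s_1,\dots,s_m\}$ and $s_{\max}:=\max\{s_1,\dots,s_m\}$, and let $0<\lambda\le\Lambda$ be such that $a\ge\lambda$ and $a_i\le\Lambda$ for all $i\in\{1,\dots,m\}$. Write $B_r$ for the open ball of $\mathbb R^n$ with radius $r$ centered at the origin. Then there is a constant $C>0$, depending only on $n,s_{\min},s_{\max},\lambda,\Lambda$, with the following property. Let $R\ge 1$, $f:B_{6\sqrt n R}\to\mathbb R$, and let $u:\mathbb R^n\to\mathbb R$ be a classical solution of $Lu=f$ in $B_{6\sqrt nR}$: $u$ is continuous in $\mathbb R^n$ and, at every point of $B_{6\sqrt nR}$, the derivatives and the (absolutely convergent) integrals in all the terms of $Lu$ with a nonzero coefficient exist, and $Lu=f$. Then, for every $t\in\left(-\frac{R}{6\sqrt n},\frac{R}{6\sqrt n}\right)$ with $t\ne0$, $$\frac{|u(te_n)-u(-te_n)|}{|t|}\le C\left(R\sup_{(x,\tau)\in B_R\times(0,R)}|f(x+\tau e_n)-f(x-\tau e_n)|+\frac{R\,\|u\|_{L^\infty(B_{6R})}}{R^{2s_{\min}}}+R\int_{2R}^{+\infty}\frac{\|u\|_{L^\infty(B_{2\rho}\setminus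 B_{\rho/2})}}{\rho^{1+2s_{\min}}}\,d\rho\right),$$ where the right-hand side may be $+\infty$. -/

import Mathlib

open MeasureTheory Set

/-- The data of the operator `L = ∑_{i < k} a_i (-Δ_{X_i})^{s_i} - a ∂²_{x_n}`, where `k = m - 1`
is the number of groups of variables preceding the last variable. -/
structure AnisoOp where
  /-- the number `m - 1` of groups of variables, the last variable `x_n` excluded -/
  k : ℕ
  /-- the number of variables in each group -/
  N : Fin k → ℕ
  N_pos : ∀ i, 1 ≤ N i
  /-- the (possibly fractional) orders -/
  s : Fin k → ℝ
  s_pos : ∀ i, 0 < s i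
  s_le_one : ∀ i, s i ≤ 1
  /-- the coefficients, which may vanish -/
  a : Fin k → ℝ
  a_nonneg : ∀ i, 0 ≤ a i
  /-- the coefficient `a = a_m` of `-∂²_{x_n}` -/
  aLast : ℝ
  aLast_pos : 0 < aLast

namespace AnisoOp

noncomputable section

/-- The dimension `n = N_1 + ⋯ + N_{m-1} + 1`. -/
abbrev dim (P : AnisoOp) : ℕ := (∑ i, P.N i) + 1

/-- The Euclidean space `ℝⁿ`. -/
abbrev Space (P : AnisoOp) : Type := EuclideanSpace ℝ (Fin P.dim)

/-- The `r`-th coordinate of the `i`-th group (consecutive blocks): counting from zero, its index is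
`N_0 + ⋯ + N_{i-1} + r`. -/
def coord (P : AnisoOp) (i : Fin P.k) (r : Fin (P.N i)) : Fin P.dim :=
  Fin.castSucc (finSigmaFinEquiv ⟨i, r⟩)

/-- The index of the last coordinate `x_n`. -/
def lastCoord (P : AnisoOp) : Fin P.dim := Fin.last (∑ i, P.N i)

/-- The vectors `e_1, …, e_n` of the standard basis. -/
def e (P : AnisoOp) (j : Fin P.dim) : P.Space := EuclideanSpace.single j 1

/-- The last vector `e_n` of the standard basis. -/
def eLast (P : AnisoOp) : P.Space := P.e P.lastCoord

/-- The increment `y^{(i)} ∈ ℝⁿ` induced by `y ∈ ℝ^{N_i}` in the `i`-th group of coordinates. -/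
def incr (P : AnisoOp) (i : Fin P.k) (y : EuclideanSpace ℝ (Fin (P.N i))) : P.Space :=
  ∑ r, y r • P.e (P.coord i r)

/-- The minimum `s_min` of `s_1, …, s_{m-1}, s_m`, where `s_m = 1`. -/
def sMin (P : AnisoOp) : ℝ :=
  (insert 1 (Finset.univ.image P.s)).min' (Finset.insert_nonempty _ _)

/-- The maximum `s_max` of `s_1, …, s_{m-1}, s_m`, where `s_m = 1`. -/
def sMax (P : AnisoOp) : ℝ :=
  (insert 1 (Finset.univ.image P.s)).max' (Finset.insert_nonempty _ _)

/-- The normalization constant `c_{N,s}` of the fractional Laplacian. -/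
def cNorm (N : ℕ) (s : ℝ) : ℝ :=
  (2 : ℝ) ^ (2 * s - 1) * Real.Gamma (s + N / 2) /
    (Real.pi ^ ((N : ℝ) / 2) * |Real.Gamma (-s)|)

/-- The second partial derivative `∂²_{x_j} u (x)`. -/
def secondPartial (P : AnisoOp) (u : P.Space → ℝ) (j : Fin P.dim) (x : P.Space) : ℝ :=
  deriv (deriv fun r : ℝ => u (x + r • P.e j)) 0

/-- `u` is twice differentiable at `x` in the `j`-th coordinate direction. -/
def TwiceDiffAt (P : AnisoOp) (u : P.Space → ℝ) (j : Fin P.dim) (x : P.Space) : Prop :=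
  (∀ᶠ r in nhds (0 : ℝ), DifferentiableAt ℝ (fun r : ℝ => u (x + r • P.e j)) r) ∧
    DifferentiableAt ℝ (deriv fun r : ℝ => u (x + r • P.e j)) 0

/-- The integrand of the fractional Laplacian in the `i`-th group of variables. -/
def fracIntegrand (P : AnisoOp) (u : P.Space → ℝ) (i : Fin P.k) (x : P.Space)
    (y : EuclideanSpace ℝ (Fin (P.N i))) : ℝ :=
  (2 * u x - u (x + P.incr i y) - u (x - P.incr i y)) / ‖y‖ ^ ((P.N i : ℝ) + 2 * P.s i)

/-- The operator `(-Δ_{X_i})^{s_i}` evaluated at `x`. -/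
def fracLap (P : AnisoOp) (u : P.Space → ℝ) (i : Fin P.k) (x : P.Space) : ℝ :=
  if P.s i = 1 then -∑ r, P.secondPartial u (P.coord i r) x
  else cNorm (P.N i) (P.s i) * ∫ y, P.fracIntegrand u i x y

/-- The operator `L`. -/
def L (P : AnisoOp) (u : P.Space → ℝ) (x : P.Space) : ℝ :=
  (∑ i, P.a i * P.fracLap u i x) - P.aLast * P.secondPartial u P.lastCoord x

/-- `L u` can be computed pointwise at `x`: every derivative and every integral that enters `L u (x)`
with a nonzero coefficient exists. -/
def ComputableAt (P : AnisoOp) (u : P.Space → ℝ) (x : P.Space) : Prop :=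
  (∀ i, P.a i ≠ 0 → P.s i = 1 → ∀ r, P.TwiceDiffAt u (P.coord i r) x) ∧
  (∀ i, P.a i ≠ 0 → P.s i ≠ 1 → Integrable (P.fracIntegrand u i x)) ∧
  P.TwiceDiffAt u P.lastCoord x

/-- `u : ℝⁿ → ℝ` is a classical solution of `L u = f` in `Ω`: `u` is continuous, and at every point
of `Ω` the operator can be computed pointwise, with value `f`. -/
def IsSolutionIn (P : AnisoOp) (u f : P.Space → ℝ) (Ω : Set P.Space) : Prop :=
  Continuous u ∧ ∀ x ∈ Ω, P.ComputableAt u x ∧ P.L u x = f x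

/-- The norm `‖u‖_{L^∞(A)}`, with values in `[0, ∞]`. -/
def normLinf (P : AnisoOp) (u : P.Space → ℝ) (A : Set P.Space) : ENNReal :=
  eLpNorm u ⊤ (volume.restrict A)

/-- The oscillation `sup_{(x,t) ∈ B_R × (0,R)} |f(x + t e_n) - f(x - t e_n)|`, in `[0, ∞]`. -/
def oscLast (P : AnisoOp) (f : P.Space → ℝ) (R : ℝ) : ENNReal :=
  ⨆ x ∈ Metric.ball (0 : P.Space) R, ⨆ t ∈ Ioo (0 : ℝ) R,
    ENNReal.ofReal |f (x + t • P.eLast) - f (x - t • P.eLast)|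

/-- The tail `∫_{2R}^∞ ‖u‖_{L^∞(B_{2ρ} ∖ B_{ρ/2})} ρ^{-1-2 s_min} dρ`, in `[0, ∞]`. -/
def tail (P : AnisoOp) (u : P.Space → ℝ) (R : ℝ) : ENNReal :=
  ∫⁻ ρ in Ioi (2 * R),
    P.normLinf u (Metric.ball 0 (2 * ρ) \ Metric.ball 0 (ρ / 2)) /
      ENNReal.ofReal (ρ ^ (1 + 2 * P.sMin))

end

end AnisoOp

open Metric Module in
theorem lintegral_fun_norm_addHaar {E : Type*} [NormedAddCommGroup E] [NormedSpace ℝ E]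
    [MeasurableSpace E] [BorelSpace E] [FiniteDimensional ℝ E] [Nontrivial E]
    (μ : Measure E) [μ.IsAddHaarMeasure] {f : ℝ → ENNReal} (hf : Measurable f) :
    ∫⁻ x, f ‖x‖ ∂μ = finrank ℝ E * μ (ball 0 1) *
      ∫⁻ y in Ioi (0 : ℝ), ENNReal.ofReal (y ^ (finrank ℝ E - 1)) * f y :=
  calc
    ∫⁻ x, f ‖x‖ ∂μ = ∫⁻ x : ({(0)}ᶜ : Set E), f ‖x.1‖ ∂(μ.comap (↑)) := by
      rw [lintegral_subtype_comap (measurableSet_singleton _).compl fun x ↦ f ‖x‖,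
        restrict_compl_singleton]
    _ = ∫⁻ x, f x.2 ∂μ.toSphere.prod (.volumeIoiPow (finrank ℝ E - 1)) := by
      simpa using μ.measurePreserving_homeomorphUnitSphereProd.lintegral_comp_emb
        (Homeomorph.measurableEmbedding _) (f ∘ Subtype.val ∘ Prod.snd)
    _ = μ.toSphere univ * ∫⁻ x : Ioi (0 : ℝ), f x ∂.volumeIoiPow (finrank ℝ E - 1) := by
      have hm : Measurable fun x : Ioi (0 : ℝ) ↦ f x := hf.comp measurable_subtype_coe
      rw [lintegral_prod _ (by fun_prop)]
      simp [mul_comm]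
    _ = _ := by
      have hm : Measurable fun x : Ioi (0 : ℝ) ↦ f x := hf.comp measurable_subtype_coe
      rw [Measure.volumeIoiPow, lintegral_withDensity_eq_lintegral_mul _ (by fun_prop) hm,
        μ.toSphere_apply_univ]
      congr 1
      exact lintegral_subtype_comap measurableSet_Ioi
        (fun y : ℝ ↦ ENNReal.ofReal (y ^ (finrank ℝ E - 1)) * f y)

/-- The second-derivative test in the absence of `C²` regularity. -/
theorem deriv_deriv_nonpos_of_isLocalMax {h : ℝ → ℝ} {x : ℝ} (hc : ContinuousAt h x)
    (hm : IsLocalMax h x) : deriv (deriv h) x ≤ 0 := by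
  by_contra! hp
  have hmin := isLocalMin_of_deriv_deriv_pos hp hm.deriv_eq_zero hc
  have hconst : h =ᶠ[nhds x] fun _ ↦ h x := by
    filter_upwards [hm, hmin] with y h1 h2 using le_antisymm h1 h2
  have := hconst.deriv.deriv_eq
  simp at this
  linarith

/-- Existence of the first derivative near `0` and of the second derivative at `0`. -/
def TwiceDerivable (φ : ℝ → ℝ) : Prop :=
  (∀ᶠ r in nhds (0 : ℝ), DifferentiableAt ℝ φ r) ∧ DifferentiableAt ℝ (deriv φ) 0

namespace TwiceDerivable

theorem comp_neg {φ : ℝ → ℝ} (h : TwiceDerivable φ) : TwiceDerivable fun r ↦ φ (-r) := by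
  have hneg : Filter.Tendsto (fun r : ℝ ↦ -r) (nhds 0) (nhds 0) := by
    simpa using (continuous_neg (G := ℝ)).tendsto 0
  refine ⟨?_, ?_⟩
  · filter_upwards [hneg.eventually h.1] with r hr
    exact hr.comp r (differentiableAt_id.neg)
  · have h1 : deriv (fun r ↦ φ (-r)) = fun r ↦ -deriv φ (-r) := by
      funext r; exact deriv_comp_neg φ r
    rw [h1]
    have h2 : DifferentiableAt ℝ (deriv φ) (-(0 : ℝ)) := by simpa using h.2
    exact (DifferentiableAt.comp (0 : ℝ) h2 (differentiableAt_id.neg)).neg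

theorem deriv_deriv_comp_neg (φ : ℝ → ℝ) :
    deriv (deriv fun r ↦ φ (-r)) 0 = deriv (deriv φ) 0 := by
  have h1 : deriv (fun r ↦ φ (-r)) = fun r ↦ -deriv φ (-r) := by
    funext r; exact deriv_comp_neg φ r
  rw [h1, deriv.fun_neg, deriv_comp_neg]
  simp

theorem sub {φ ψ : ℝ → ℝ} (h : TwiceDerivable φ) (k : TwiceDerivable ψ) :
    TwiceDerivable (fun r ↦ φ r - ψ r) ∧
      deriv (deriv fun r ↦ φ r - ψ r) 0 = deriv (deriv φ) 0 - deriv (deriv ψ) 0 := by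
  have h1 : deriv (fun r ↦ φ r - ψ r) =ᶠ[nhds 0] fun r ↦ deriv φ r - deriv ψ r := by
    filter_upwards [h.1, k.1] with r hr kr using deriv_fun_sub hr kr
  refine ⟨⟨?_, (h.2.sub k.2).congr_of_eventuallyEq h1⟩, ?_⟩
  · filter_upwards [h.1, k.1] with r hr kr using hr.sub kr
  · rw [h1.deriv_eq, deriv_fun_sub h.2 k.2]

theorem add {φ ψ : ℝ → ℝ} (h : TwiceDerivable φ) (k : TwiceDerivable ψ) :
    TwiceDerivable (fun r ↦ φ r + ψ r) ∧
      deriv (deriv fun r ↦ φ r + ψ r) 0 = deriv (deriv φ) 0 + deriv (deriv ψ) 0 := by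
  have h1 : deriv (fun r ↦ φ r + ψ r) =ᶠ[nhds 0] fun r ↦ deriv φ r + deriv ψ r := by
    filter_upwards [h.1, k.1] with r hr kr using deriv_fun_add hr kr
  refine ⟨⟨?_, (h.2.add k.2).congr_of_eventuallyEq h1⟩, ?_⟩
  · filter_upwards [h.1, k.1] with r hr kr using hr.add kr
  · rw [h1.deriv_eq, deriv_fun_add h.2 k.2]

theorem const_mul_sq (b : ℝ) : TwiceDerivable (fun r : ℝ ↦ b * r ^ 2) ∧
    deriv (deriv fun r : ℝ ↦ b * r ^ 2) 0 = 2 * b := by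
  have h1 : deriv (fun r : ℝ ↦ b * r ^ 2) = fun r ↦ (2 * b) * r := by
    funext r
    have := ((hasDerivAt_pow 2 r).const_mul b).deriv
    rw [this]; push_cast; ring
  refine ⟨⟨.of_forall fun r ↦ by fun_prop, by rw [h1]; fun_prop⟩, ?_⟩
  rw [h1]
  simp

/-- Comparison of second derivatives by means of symmetric second differences. -/
theorem deriv_deriv_sub_le {φ ψ : ℝ → ℝ} {b : ℝ} (h : TwiceDerivable φ) (k : TwiceDerivable ψ)
    (hle : ∀ᶠ r in nhds (0 : ℝ),
      (φ r + φ (-r) - 2 * φ 0) - (ψ r + ψ (-r) - 2 * ψ 0) ≤ b * r ^ 2) :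
    deriv (deriv φ) 0 - deriv (deriv ψ) 0 ≤ b := by
  obtain ⟨d1, e1⟩ := h.add h.comp_neg
  obtain ⟨d2, e2⟩ := k.add k.comp_neg
  obtain ⟨d3, e3⟩ := d1.sub d2
  obtain ⟨d4, e4⟩ := const_mul_sq b
  obtain ⟨d5, e5⟩ := d3.sub d4
  have hmax := deriv_deriv_nonpos_of_isLocalMax (d5.1.self_of_nhds).continuousAt (by
    filter_upwards [hle] with r hr
    simp only [neg_zero]
    linarith)
  rw [e5, e3, e1, e2, e4, deriv_deriv_comp_neg, deriv_deriv_comp_neg] at hmax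
  linarith

end TwiceDerivable

/-- The normalization constant of the fractional Laplacian vanishes linearly as `s → 1`. -/
theorem exists_cNorm_le {N : ℕ} (hN : 1 ≤ N) :
    ∃ C : ℝ, 0 ≤ C ∧ ∀ s : ℝ, 0 < s → s < 1 → AnisoOp.cNorm N s ≤ C * (1 - s) := by
  have hN1 : (1 : ℝ) ≤ N := by exact_mod_cast hN
  let F : ℝ → ℝ := fun s ↦ (2 : ℝ) ^ (2 * s - 1) * Real.Gamma (s + N / 2) * s /
    (Real.pi ^ ((N : ℝ) / 2) * Real.Gamma (2 - s))
  have hF : ContinuousOn F (Icc 0 1) := by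
    have hΓ : ∀ x : ℝ, 0 < x → ContinuousAt Real.Gamma x := fun x hx ↦
      (Real.differentiableAt_Gamma fun m ↦ by
        have : (0 : ℝ) ≤ m := m.cast_nonneg
        linarith).continuousAt
    intro s hs
    apply ContinuousAt.continuousWithinAt
    have h1 : ContinuousAt (fun s : ℝ ↦ Real.Gamma (s + N / 2)) s :=
      ContinuousAt.comp (g := Real.Gamma) (hΓ _ (by linarith [hs.1])) (by fun_prop)
    have h2 : ContinuousAt (fun s : ℝ ↦ Real.Gamma (2 - s)) s :=
      ContinuousAt.comp (g := Real.Gamma) (hΓ _ (by linarith [hs.2])) (by fun_prop)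
    have h3 : ContinuousAt (fun s : ℝ ↦ (2 : ℝ) ^ (2 * s - 1)) s :=
      ContinuousAt.rpow (by fun_prop) (by fun_prop) (by simp)
    have h4 : 0 < Real.Gamma (2 - s) := Real.Gamma_pos_of_pos (by linarith [hs.2])
    have h5 : 0 < Real.pi ^ ((N : ℝ) / 2) := Real.rpow_pos_of_pos Real.pi_pos _
    exact ((h3.mul h1).mul continuousAt_id).div (continuousAt_const.mul h2) (by positivity)
  obtain ⟨C, hC⟩ := isCompact_Icc.bddAbove_image hF
  refine ⟨max C 0, le_max_right _ _, fun s h0 h1 ↦ ?_⟩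
  have hFs : F s ≤ C := hC ⟨s, ⟨h0.le, h1.le⟩, rfl⟩
  have hg1 : Real.Gamma (1 - s) = -s * Real.Gamma (-s) := by
    have := Real.Gamma_add_one (s := -s) (by linarith)
    rw [← this]; ring_nf
  have hg2 : Real.Gamma (2 - s) = (1 - s) * Real.Gamma (1 - s) := by
    have := Real.Gamma_add_one (s := 1 - s) (by linarith)
    rw [← this]; ring_nf
  have hpos : 0 < Real.Gamma (1 - s) := Real.Gamma_pos_of_pos (by linarith)
  have habs : |Real.Gamma (-s)| = Real.Gamma (1 - s) / s := by
    have : Real.Gamma (-s) = -(Real.Gamma (1 - s) / s) := by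
      rw [hg1]; field_simp
    rw [this, abs_neg, abs_of_pos (by positivity)]
  have heq : AnisoOp.cNorm N s = F s * (1 - s) := by
    have h5 : 0 < Real.pi ^ ((N : ℝ) / 2) := Real.rpow_pos_of_pos Real.pi_pos _
    have h6 : 0 < 1 - s := by linarith
    simp only [AnisoOp.cNorm, F, habs, hg2]
    field_simp
  rw [heq]
  exact mul_le_mul_of_nonneg_right (hFs.trans (le_max_left _ _)) (by linarith)

theorem cNorm_nonneg (N : ℕ) {s : ℝ} (hs : 0 < s) : 0 ≤ AnisoOp.cNorm N s := by
  have : 0 < Real.Gamma (s + N / 2) := Real.Gamma_pos_of_pos (by positivity)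
  unfold AnisoOp.cNorm
  positivity

/-- Pointwise values of continuous functions are bounded by the essential supremum. -/
theorem enorm_le_eLpNorm_top {X : Type*} [TopologicalSpace X] [MeasurableSpace X]
    [BorelSpace X] {μ : Measure X} [μ.IsOpenPosMeasure] {u : X → ℝ} (hu : Continuous u)
    {U A : Set X} (hU : IsOpen U) (hUA : U ⊆ A) {x : X} (hx : x ∈ U) :
    ‖u x‖ₑ ≤ eLpNorm u ⊤ (μ.restrict A) := by
  refine le_trans ?_ (eLpNorm_mono_measure u (Measure.restrict_mono_set μ hUA))
  rw [eLpNorm_exponent_top]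
  by_contra! hlt
  have hae : ∀ᵐ y ∂(μ.restrict U), ‖u y‖ₑ ≤ eLpNormEssSup u (μ.restrict U) :=
    ae_le_eLpNormEssSup
  rw [ae_restrict_iff' hU.measurableSet, ae_iff] at hae
  have hopen : IsOpen (U ∩ {y | eLpNormEssSup u (μ.restrict U) < ‖u y‖ₑ}) :=
    hU.inter (isOpen_lt continuous_const hu.enorm)
  refine (hopen.measure_pos μ ⟨x, hx, hlt⟩).ne' ?_
  convert hae using 2
  ext y; simp

theorem lintegral_rpow_Ioo_le {r p : ℝ} (hr : 0 < r) (hp : -1 < p) :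
    ∫⁻ y in Ioo 0 r, ENNReal.ofReal (y ^ p) = ENNReal.ofReal (r ^ (p + 1) / (p + 1)) := by
  have hi : IntegrableOn (fun y : ℝ ↦ y ^ p) (Ioc 0 r) :=
    (intervalIntegrable_iff_integrableOn_Ioc_of_le hr.le).1
      (intervalIntegral.intervalIntegrable_rpow' hp)
  rw [← ofReal_integral_eq_lintegral_ofReal (hi.mono_set Ioo_subset_Ioc_self)
    ((ae_restrict_iff' measurableSet_Ioo).2 (.of_forall fun y hy ↦
      Real.rpow_nonneg hy.1.le _)), ← integral_Ioc_eq_integral_Ioo,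
    ← intervalIntegral.integral_of_le hr.le, integral_rpow (Or.inl hp),
    Real.zero_rpow (by linarith), sub_zero]

theorem lintegral_kernel_le {N : ℕ} (hN : 1 ≤ N) {s b r : ℝ} (hs : s < 1)
    (hb : 0 ≤ b) (hr : 0 < r) {G : ℝ → ENNReal} (hG : Measurable G) :
    ∫⁻ y : EuclideanSpace ℝ (Fin N), (if ‖y‖ < r then ENNReal.ofReal (b * ‖y‖ ^ 2) else G ‖y‖) /
        ENNReal.ofReal (‖y‖ ^ ((N : ℝ) + 2 * s)) ≤
      N * volume (Metric.ball (0 : EuclideanSpace ℝ (Fin N)) 1) *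
        (ENNReal.ofReal (b * (r ^ (2 - 2 * s) / (2 - 2 * s))) +
          ∫⁻ ρ in Ici r, G ρ / ENNReal.ofReal (ρ ^ (1 + 2 * s))) := by
  have : NeZero N := ⟨by omega⟩
  have hm : Measurable fun ρ : ℝ ↦ (if ρ < r then ENNReal.ofReal (b * ρ ^ 2) else G ρ) /
      ENNReal.ofReal (ρ ^ ((N : ℝ) + 2 * s)) :=
    (Measurable.ite measurableSet_Iio (by fun_prop) hG).div (by fun_prop)
  rw [lintegral_fun_norm_addHaar volume hm, finrank_euclideanSpace_fin]
  gcongr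
  rw [← Ioo_union_Ici_eq_Ioi hr]
  refine (lintegral_union_le _ _ _).trans (add_le_add ?_ ?_)
  · rw [ENNReal.ofReal_mul hb]
    have h2 := lintegral_rpow_Ioo_le hr (p := 1 - 2 * s) (by linarith)
    rw [show 1 - 2 * s + 1 = 2 - 2 * s by ring] at h2
    rw [← h2, ← lintegral_const_mul' _ _ ENNReal.ofReal_ne_top]
    refine setLIntegral_mono' measurableSet_Ioo fun y hy ↦ le_of_eq ?_
    have hy0 := hy.1
    rw [if_pos hy.2, ← ENNReal.ofReal_div_of_pos (by positivity),
      ← ENNReal.ofReal_mul (by positivity), ← ENNReal.ofReal_mul hb]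
    congr 1
    rw [div_eq_mul_inv, ← Real.rpow_neg hy0.le, ← Real.rpow_natCast, ← Real.rpow_natCast,
      Nat.cast_sub hN]
    calc _ = b * (y ^ ((N : ℝ) - (1 : ℕ)) * y ^ ((2 : ℕ) : ℝ) * y ^ (-((N : ℝ) + 2 * s))) := by
            ring
      _ = _ := by
        rw [← Real.rpow_add hy0, ← Real.rpow_add hy0]
        congr 2; push_cast; ring
  · refine setLIntegral_mono' measurableSet_Ici fun y hy ↦ le_of_eq ?_
    have hy0 : 0 < y := hr.trans_le hy
    rw [if_neg (not_lt.2 hy), div_eq_mul_inv, div_eq_mul_inv, mul_left_comm,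
      ← ENNReal.ofReal_inv_of_pos (by positivity), ← ENNReal.ofReal_inv_of_pos (by positivity),
      ← ENNReal.ofReal_mul (by positivity), ← Real.rpow_neg hy0.le, ← Real.rpow_neg hy0.le,
      ← Real.rpow_natCast, Nat.cast_sub hN, ← Real.rpow_add hy0]
    congr 3; push_cast; ring

/-- `D` controls from below, uniformly in the order `s`, the normalized integrals of second
increments `-S` in `ℝ^N` with a quadratic bound near the origin and a radial bound far away. -/
def KernelBound (N : ℕ) (D : ℝ) : Prop :=
  0 ≤ D ∧ ∀ (s b r : ℝ) (G : ℝ → ENNReal) (S : EuclideanSpace ℝ (Fin N) → ℝ),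
    0 < s → s < 1 → 0 ≤ b → 0 < r → Measurable G →
    (∀ y, ‖y‖ < r → S y ≤ b * ‖y‖ ^ 2) → (∀ y, r ≤ ‖y‖ → ENNReal.ofReal (S y) ≤ G ‖y‖) →
    Integrable (fun y ↦ -S y / ‖y‖ ^ ((N : ℝ) + 2 * s)) →
    ∫⁻ ρ in Ici r, G ρ / ENNReal.ofReal (ρ ^ (1 + 2 * s)) ≠ ⊤ →
    -(D * (b * r ^ (2 - 2 * s) +
      (∫⁻ ρ in Ici r, G ρ / ENNReal.ofReal (ρ ^ (1 + 2 * s))).toReal)) ≤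
      AnisoOp.cNorm N s * ∫ y, -S y / ‖y‖ ^ ((N : ℝ) + 2 * s)

theorem KernelBound.mono {N : ℕ} {D D' : ℝ} (h : KernelBound N D) (hD : D ≤ D') :
    KernelBound N D' := by
  refine ⟨h.1.trans hD, fun s b r G S hs hs1 hb hr hG h1 h2 hi hJ ↦ ?_⟩
  refine le_trans ?_ (h.2 s b r G S hs hs1 hb hr hG h1 h2 hi hJ)
  gcongr

theorem exists_kernelBound {N : ℕ} (hN : 1 ≤ N) : ∃ D, KernelBound N D := by
  obtain ⟨C, hC0, hC⟩ := exists_cNorm_le hN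
  set V : ENNReal := N * volume (Metric.ball (0 : EuclideanSpace ℝ (Fin N)) 1) with hV
  have hVtop : V ≠ ⊤ := ENNReal.mul_ne_top (by simp) measure_ball_lt_top.ne
  refine ⟨C * V.toReal, by positivity, fun s b r G S hs hs1 hb hr hG h1 h2 hi hJ ↦ ?_⟩
  set J := ∫⁻ ρ in Ici r, G ρ / ENNReal.ofReal (ρ ^ (1 + 2 * s)) with hJdef
  have hint : -(V.toReal * (b * (r ^ (2 - 2 * s) / (2 - 2 * s)) + J.toReal)) ≤
      ∫ y, -S y / ‖y‖ ^ ((N : ℝ) + 2 * s) := by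
    rw [integral_eq_lintegral_pos_part_sub_lintegral_neg_part hi]
    have hle : ∫⁻ y, ENNReal.ofReal (-(-S y / ‖y‖ ^ ((N : ℝ) + 2 * s))) ≤
        V * (ENNReal.ofReal (b * (r ^ (2 - 2 * s) / (2 - 2 * s))) + J) := by
      refine le_trans (lintegral_mono fun y ↦ ?_) (lintegral_kernel_le hN hs1 hb hr hG)
      rcases eq_or_ne y 0 with rfl | hy
      · have : (N : ℝ) + 2 * s ≠ 0 := by positivity
        simp [Real.zero_rpow this]
      have hy' : 0 < ‖y‖ := norm_pos_iff.2 hy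
      rw [neg_div, neg_neg, ENNReal.ofReal_div_of_pos (by positivity)]
      gcongr
      split_ifs with hyr
      · exact ENNReal.ofReal_le_ofReal (h1 y hyr)
      · exact h2 y (not_lt.1 hyr)
    have hnn : 0 ≤ b * (r ^ (2 - 2 * s) / (2 - 2 * s)) := by
      have : 0 < 2 - 2 * s := by linarith
      positivity
    have := ENNReal.toReal_mono (ENNReal.mul_ne_top hVtop
      (ENNReal.add_ne_top.2 ⟨ENNReal.ofReal_ne_top, hJ⟩)) hle
    rw [ENNReal.toReal_mul, ENNReal.toReal_add ENNReal.ofReal_ne_top hJ,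
      ENNReal.toReal_ofReal hnn] at this
    have h0 : 0 ≤ (∫⁻ y, ENNReal.ofReal (-S y / ‖y‖ ^ ((N : ℝ) + 2 * s))).toReal :=
      ENNReal.toReal_nonneg
    linarith
  have h1s : 0 < 1 - s := by linarith
  have hpow : 0 ≤ r ^ (2 - 2 * s) := by positivity
  calc -(C * V.toReal * (b * r ^ (2 - 2 * s) + J.toReal))
      ≤ -(C * (1 - s) * (V.toReal * (b * (r ^ (2 - 2 * s) / (2 - 2 * s)) + J.toReal))) := by
        have e : (1 - s) * (b * (r ^ (2 - 2 * s) / (2 - 2 * s)) + J.toReal) ≤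
            b * r ^ (2 - 2 * s) + J.toReal := by
          have e1 : (1 - s) * (b * (r ^ (2 - 2 * s) / (2 - 2 * s))) =
              b * r ^ (2 - 2 * s) / 2 := by
            rw [show 2 - 2 * s = 2 * (1 - s) by ring]; field_simp
          have e2 : 0 ≤ b * r ^ (2 - 2 * s) := by positivity
          have e3 : 0 ≤ s * J.toReal := by positivity
          rw [mul_add, e1]; linarith
        have := mul_le_mul_of_nonneg_left e (show 0 ≤ C * V.toReal by positivity)
        linarith
    _ ≤ -(AnisoOp.cNorm N s * (V.toReal * (b * (r ^ (2 - 2 * s) / (2 - 2 * s)) + J.toReal))) := by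
        have : 0 ≤ V.toReal * (b * (r ^ (2 - 2 * s) / (2 - 2 * s)) + J.toReal) := by
          have : 0 < 2 - 2 * s := by linarith
          positivity
        have := mul_le_mul_of_nonneg_right (hC s hs hs1) this
        linarith
    _ ≤ _ := by
        have := mul_le_mul_of_nonneg_left hint (cNorm_nonneg N hs)
        linarith

/-- The supremum of `|u|` over the open annulus of radii `ρ / 2` and `2 ρ`. -/
noncomputable def annulusSup {E : Type*} [NormedAddCommGroup E] (u : E → ℝ) (ρ : ℝ) : ENNReal :=
  ⨆ z : E, {ρ : ℝ | ρ / 2 < ‖z‖ ∧ ‖z‖ < 2 * ρ}.indicator (fun _ ↦ ‖u z‖ₑ) ρ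

theorem measurable_annulusSup {E : Type*} [NormedAddCommGroup E] (u : E → ℝ) :
    Measurable (annulusSup u) := by
  refine LowerSemicontinuous.measurable (lowerSemicontinuous_iSup fun z ↦ ?_)
  have h1 : IsOpen {ρ : ℝ | ρ / 2 < ‖z‖} := isOpen_lt (by fun_prop) (by fun_prop)
  have h2 : IsOpen {ρ : ℝ | ‖z‖ < 2 * ρ} := isOpen_lt (by fun_prop) (by fun_prop)
  exact (h1.inter h2).lowerSemicontinuous_indicator zero_le

theorem enorm_le_annulusSup {E : Type*} [NormedAddCommGroup E] (u : E → ℝ) {ρ : ℝ} {z : E}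
    (h1 : ρ / 2 < ‖z‖) (h2 : ‖z‖ < 2 * ρ) : ‖u z‖ₑ ≤ annulusSup u ρ := by
  refine le_trans (le_of_eq ?_) (le_iSup _ z)
  rw [indicator_of_mem (show ρ ∈ {ρ : ℝ | ρ / 2 < ‖z‖ ∧ ‖z‖ < 2 * ρ} from ⟨h1, h2⟩)]

namespace AnisoOp

variable (P : AnisoOp)

theorem annulusSup_le_normLinf {u : P.Space → ℝ} (hu : Continuous u) (ρ : ℝ) :
    annulusSup u ρ ≤ P.normLinf u (Metric.ball 0 (2 * ρ) \ Metric.ball 0 (ρ / 2)) := by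
  refine iSup_le fun z ↦ ?_
  by_cases hz : ρ ∈ {ρ : ℝ | ρ / 2 < ‖z‖ ∧ ‖z‖ < 2 * ρ}
  · rw [indicator_of_mem hz]
    refine enorm_le_eLpNorm_top hu (U := Metric.ball 0 (2 * ρ) ∩ (Metric.closedBall 0 (ρ / 2))ᶜ)
      (Metric.isOpen_ball.inter Metric.isClosed_closedBall.isOpen_compl) ?_ ?_
    · exact fun y hy ↦ ⟨hy.1, fun h ↦ hy.2 (Metric.ball_subset_closedBall h)⟩
    · have hz' : ρ / 2 < ‖z‖ ∧ ‖z‖ < 2 * ρ := hz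
      simpa [and_comm] using hz'
  · rw [indicator_of_notMem hz]; exact zero_le

theorem sMin_le_one : P.sMin ≤ 1 := Finset.min'_le _ _ (by simp)

theorem sMin_le (i : Fin P.k) : P.sMin ≤ P.s i := Finset.min'_le _ _ (by simp)

theorem N_le_dim (i : Fin P.k) : P.N i ≤ P.dim :=
  (Finset.single_le_sum (f := P.N) (fun _ _ ↦ Nat.zero_le _) (Finset.mem_univ i)).trans
    (Nat.le_succ _)

theorem k_le_dim : P.k ≤ P.dim := by
  have : ∑ _i : Fin P.k, 1 ≤ ∑ i, P.N i := Finset.sum_le_sum fun i _ ↦ P.N_pos i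
  simp at this
  exact this.trans (Nat.le_succ _)

theorem norm_e (j : Fin P.dim) : ‖P.e j‖ = 1 := by simp [e]

theorem coord_injective (i : Fin P.k) : Function.Injective (P.coord i) := by
  intro r r' h
  have := finSigmaFinEquiv.injective (Fin.castSucc_injective _ h)
  simpa using this

theorem norm_incr (i : Fin P.k) (y : EuclideanSpace ℝ (Fin (P.N i))) : ‖P.incr i y‖ = ‖y‖ := by
  have ho : Orthonormal ℝ fun r ↦ P.e (P.coord i r) := by
    have := (EuclideanSpace.basisFun (Fin P.dim) ℝ).orthonormal.comp _ (P.coord_injective i)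
    simpa [Function.comp_def, e] using this
  have h2 : ‖P.incr i y‖ ^ 2 = ‖y‖ ^ 2 := by
    rw [← real_inner_self_eq_norm_sq, incr, ho.inner_sum, EuclideanSpace.norm_sq_eq]
    simp [sq]
  exact (sq_eq_sq₀ (norm_nonneg _) (norm_nonneg _)).1 h2

/-- The second increment of `u` at `p` along `z`. -/
def incr₂ (u : P.Space → ℝ) (p z : P.Space) : ℝ := u (p + z) + u (p - z) - 2 * u p

theorem secondPartial_sub_le {u : P.Space → ℝ} {j : Fin P.dim} {p q : P.Space} {b : ℝ}
    (hp : P.TwiceDiffAt u j p) (hq : P.TwiceDiffAt u j q)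
    (h : ∀ᶠ r in nhds (0 : ℝ), P.incr₂ u p (r • P.e j) - P.incr₂ u q (r • P.e j) ≤ b * r ^ 2) :
    P.secondPartial u j p - P.secondPartial u j q ≤ b := by
  refine TwiceDerivable.deriv_deriv_sub_le hp hq ?_
  filter_upwards [h] with r hr
  simpa [incr₂, sub_eq_add_neg] using hr

end AnisoOp

namespace AnisoOp

variable (P : AnisoOp)

theorem lintegral_annulusSup_le_tail {u : P.Space → ℝ} (hu : Continuous u) {R : ℝ} (hR : 1 ≤ R)
    {s : ℝ} (hs : P.sMin ≤ s) :
    ∫⁻ ρ in Ici (4 * R), (4 * annulusSup u ρ) / ENNReal.ofReal (ρ ^ (1 + 2 * s)) ≤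
      4 * P.tail u R := by
  rw [tail, ← lintegral_const_mul' _ _ (by simp)]
  refine (setLIntegral_mono' measurableSet_Ici fun ρ hρ ↦ ?_).trans
    (lintegral_mono_set fun ρ hρ ↦ ?_)
  · have hρ1 : 1 ≤ ρ := by have : 4 * R ≤ ρ := hρ; linarith
    rw [mul_div_assoc]
    gcongr
    exact P.annulusSup_le_normLinf hu ρ
  · have : 4 * R ≤ ρ := hρ
    show 2 * R < ρ
    linarith

/-- Lower bound for the difference of the values of one of the terms of `L` at two points. -/
theorem fracLap_sub_ge {u : P.Space → ℝ} (hu : Continuous u) {D : ℝ} (i : Fin P.k)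
    (hD : KernelBound (P.N i) D) (hai : P.a i ≠ 0) {R M : ℝ} (hR : 1 ≤ R) (hM : 0 ≤ M)
    {p q : P.Space} (hp : P.ComputableAt u p) (hq : P.ComputableAt u q)
    (hpn : ‖p‖ < 2 * R) (hqn : ‖q‖ < 2 * R) (hpq : u q ≤ u p)
    (hS : ∀ z, ‖z‖ < 4 * R → P.incr₂ u p z - P.incr₂ u q z ≤ 2 * (M / R ^ 2) * ‖z‖ ^ 2)
    (hT : P.tail u R ≠ ⊤) :
    -((32 * D + 2 * P.dim) * (M * R ^ (-(2 * P.sMin)) + (P.tail u R).toReal)) ≤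
      P.fracLap u i p - P.fracLap u i q := by
  have hR0 : 0 < R := by linarith
  have hT0 : 0 ≤ (P.tail u R).toReal := ENNReal.toReal_nonneg
  have hD0 := hD.1
  have hpow : R ^ (-(2 * P.s i)) ≤ R ^ (-(2 * P.sMin)) :=
    Real.rpow_le_rpow_of_exponent_le hR (by linarith [P.sMin_le i])
  set Q := R ^ (-(2 * P.sMin)) with hQdef
  have hQ : 0 < Q := Real.rpow_pos_of_pos hR0 _
  by_cases hs : P.s i = 1
  · have hN : (P.N i : ℝ) ≤ P.dim := by exact_mod_cast P.N_le_dim i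
    have hR2 : 1 / R ^ 2 ≤ Q := by
      refine le_trans (le_of_eq ?_) hpow
      rw [hs, Real.rpow_neg hR0.le, mul_one, one_div]
      norm_cast
    simp only [fracLap, if_pos hs]
    have hle : ∀ r, P.secondPartial u (P.coord i r) p - P.secondPartial u (P.coord i r) q ≤
        2 * (M / R ^ 2) := fun r ↦ by
      refine P.secondPartial_sub_le (hp.1 i hai hs r) (hq.1 i hai hs r) ?_
      filter_upwards [Metric.ball_mem_nhds (0 : ℝ) (show 0 < 4 * R by positivity)] with ρ hρ
      have hnorm : ‖ρ • P.e (P.coord i r)‖ = |ρ| := by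
        rw [norm_smul, P.norm_e, mul_one, Real.norm_eq_abs]
      have := hS (ρ • P.e (P.coord i r)) (by rw [hnorm]; simpa using hρ)
      rwa [hnorm, sq_abs] at this
    have hsum := Finset.sum_le_sum fun r (_ : r ∈ Finset.univ) ↦ hle r
    rw [Finset.sum_sub_distrib] at hsum
    simp only [Finset.sum_const, Finset.card_univ, Fintype.card_fin, nsmul_eq_mul] at hsum
    have h1 : (P.N i : ℝ) * (2 * (M / R ^ 2)) ≤ 2 * P.dim * (M * Q) := by
      have : M / R ^ 2 ≤ M * Q := by
        rw [div_eq_mul_one_div]; gcongr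
      calc (P.N i : ℝ) * (2 * (M / R ^ 2)) ≤ P.dim * (2 * (M * Q)) := by gcongr
        _ = _ := by ring
    have h2 : 0 ≤ 32 * D * (M * Q) := by positivity
    have h3 : 0 ≤ (32 * D + 2 * P.dim) * (P.tail u R).toReal := by positivity
    linarith
  · have hs1 : P.s i < 1 := lt_of_le_of_ne (P.s_le_one i) hs
    simp only [fracLap, if_neg hs]
    rw [← mul_sub, ← integral_sub (hp.2.1 i hai hs) (hq.2.1 i hai hs)]
    set S : EuclideanSpace ℝ (Fin (P.N i)) → ℝ := fun y ↦
      P.incr₂ u p (P.incr i y) - P.incr₂ u q (P.incr i y) with hSdef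
    have heq : (fun y ↦ P.fracIntegrand u i p y - P.fracIntegrand u i q y) =
        fun y ↦ -S y / ‖y‖ ^ ((P.N i : ℝ) + 2 * P.s i) := by
      funext y
      simp only [fracIntegrand, hSdef, incr₂]
      ring
    have hint := (hp.2.1 i hai hs).sub (hq.2.1 i hai hs)
    have heq' : P.fracIntegrand u i p - P.fracIntegrand u i q =
        fun y ↦ -S y / ‖y‖ ^ ((P.N i : ℝ) + 2 * P.s i) := heq
    rw [heq'] at hint
    rw [heq]
    have htail := P.lintegral_annulusSup_le_tail hu hR (P.sMin_le i)
    have hfin : 4 * P.tail u R ≠ ⊤ := ENNReal.mul_ne_top (by simp) hT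
    have hfar : ∀ y, 4 * R ≤ ‖y‖ → ENNReal.ofReal (S y) ≤ 4 * annulusSup u ‖y‖ := by
      intro y hy
      have hb : ∀ x : P.Space, ‖x‖ < 2 * R → ‖u (x + P.incr i y)‖ₑ ≤ annulusSup u ‖y‖ ∧
          ‖u (x - P.incr i y)‖ₑ ≤ annulusSup u ‖y‖ := by
        intro x hx
        have e := P.norm_incr i y
        constructor
        · refine enorm_le_annulusSup u ?_ ?_
          · have := norm_sub_norm_le (P.incr i y) (-x)
            rw [sub_neg_eq_add, norm_neg, add_comm (P.incr i y)] at this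
            linarith
          · have := norm_add_le x (P.incr i y)
            linarith
        · refine enorm_le_annulusSup u ?_ ?_
          · have := norm_sub_norm_le (P.incr i y) x
            rw [norm_sub_rev] at this
            linarith
          · have := norm_sub_le x (P.incr i y)
            linarith
      have hle : S y ≤ |u (p + P.incr i y)| + |u (p - P.incr i y)| +
          (|u (q + P.incr i y)| + |u (q - P.incr i y)|) := by
        simp only [hSdef, incr₂]
        linarith [le_abs_self (u (p + P.incr i y)), le_abs_self (u (p - P.incr i y)),
          neg_abs_le (u (q + P.incr i y)), neg_abs_le (u (q - P.incr i y))]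
      refine (ENNReal.ofReal_le_ofReal hle).trans ?_
      rw [ENNReal.ofReal_add (by positivity) (by positivity),
        ENNReal.ofReal_add (by positivity) (by positivity),
        ENNReal.ofReal_add (by positivity) (by positivity)]
      simp only [← Real.enorm_eq_ofReal_abs]
      refine (add_le_add (add_le_add (hb p hpn).1 (hb p hpn).2)
        (add_le_add (hb q hqn).1 (hb q hqn).2)).trans (le_of_eq ?_)
      ring
    refine le_trans ?_ (hD.2 (P.s i) (2 * (M / R ^ 2)) (4 * R) (fun ρ ↦ 4 * annulusSup u ρ) S
      (P.s_pos i) hs1 (by positivity) (by positivity)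
      ((measurable_annulusSup u).const_mul 4)
      (fun y hy ↦ by simpa only [P.norm_incr i y] using hS (P.incr i y) (by rwa [P.norm_incr i y]))
      hfar hint (ne_top_of_le_ne_top hfin htail))
    have hJ := ENNReal.toReal_mono hfin htail
    rw [ENNReal.toReal_mul] at hJ
    simp only [ENNReal.toReal_ofNat] at hJ
    have hnear : 2 * (M / R ^ 2) * (4 * R) ^ (2 - 2 * P.s i) ≤ 32 * (M * Q) := by
      have h4 : (4 : ℝ) ^ (2 - 2 * P.s i) ≤ 16 := by
        refine (Real.rpow_le_rpow_of_exponent_le (by norm_num)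
          (show 2 - 2 * P.s i ≤ 2 by linarith [P.s_pos i])).trans (by norm_num)
      have hRp : R ^ (2 - 2 * P.s i) = R ^ 2 * R ^ (-(2 * P.s i)) := by
        rw [sub_eq_add_neg, Real.rpow_add hR0]; norm_cast
      rw [Real.mul_rpow (by norm_num) hR0.le, hRp]
      calc 2 * (M / R ^ 2) * (4 ^ (2 - 2 * P.s i) * (R ^ 2 * R ^ (-(2 * P.s i))))
          = 2 * M * (4 ^ (2 - 2 * P.s i) * R ^ (-(2 * P.s i))) := by field_simp
        _ ≤ 2 * M * (16 * Q) := by gcongr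
        _ = 32 * (M * Q) := by ring
    have h1 := mul_le_mul_of_nonneg_left (add_le_add hnear hJ) hD0
    have h2 : 0 ≤ 2 * P.dim * (M * Q + (P.tail u R).toReal) := by positivity
    have h3 : 0 ≤ 28 * (D * (P.tail u R).toReal) := by positivity
    linarith

theorem L_sub_ge {u : P.Space → ℝ} (hu : Continuous u) {D : ℝ}
    (hD : ∀ i, KernelBound (P.N i) D) (hD0 : 0 ≤ D) {lo hi : ℝ} (hlo : lo ≤ P.aLast)
    (hhi0 : 0 ≤ hi) (hhi : ∀ i, P.a i ≤ hi) {R M K : ℝ} (hR : 1 ≤ R) (hM : 0 ≤ M) (hK : 0 ≤ K)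
    {p q : P.Space} (hp : P.ComputableAt u p) (hq : P.ComputableAt u q)
    (hpn : ‖p‖ < 2 * R) (hqn : ‖q‖ < 2 * R) (hpq : u q ≤ u p)
    (hS : ∀ z, ‖z‖ < 4 * R → P.incr₂ u p z - P.incr₂ u q z ≤ 2 * (M / R ^ 2) * ‖z‖ ^ 2)
    (hlast : ∀ᶠ r in nhds (0 : ℝ),
      P.incr₂ u p (r • P.eLast) - P.incr₂ u q (r • P.eLast) ≤ -(2 * K) * r ^ 2)
    (hT : P.tail u R ≠ ⊤) :
    2 * K * lo - P.dim * hi * ((32 * D + 2 * P.dim) *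
        (M * R ^ (-(2 * P.sMin)) + (P.tail u R).toReal)) ≤ P.L u p - P.L u q := by
  set E := (32 * D + 2 * P.dim) * (M * R ^ (-(2 * P.sMin)) + (P.tail u R).toReal) with hEdef
  have hE : 0 ≤ E := by positivity
  have hterm : ∀ i, -(hi * E) ≤ P.a i * P.fracLap u i p - P.a i * P.fracLap u i q := by
    intro i
    by_cases hai : P.a i = 0
    · simp only [hai, zero_mul, sub_zero]
      have := mul_nonneg hhi0 hE
      linarith
    · have h1 := P.fracLap_sub_ge hu i (hD i) hai hR hM hp hq hpn hqn hpq hS hT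
      have h2 := mul_le_mul_of_nonneg_left h1 (P.a_nonneg i)
      have h3 := mul_le_mul_of_nonneg_right (hhi i) hE
      rw [← hEdef] at h2
      linarith
  have hsum := Finset.sum_le_sum fun i (_ : i ∈ Finset.univ) ↦ hterm i
  rw [Finset.sum_sub_distrib] at hsum
  simp only [Finset.sum_const, Finset.card_univ, Fintype.card_fin, nsmul_eq_mul] at hsum
  have hk : (P.k : ℝ) * (hi * E) ≤ P.dim * (hi * E) := by
    have : (P.k : ℝ) ≤ P.dim := by exact_mod_cast P.k_le_dim
    gcongr
  have hl := P.secondPartial_sub_le hp.2.2 hq.2.2 hlast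
  have hl2 := mul_le_mul_of_nonneg_left hl P.aLast_pos.le
  have hl3 := mul_le_mul_of_nonneg_left hlo (show 0 ≤ 2 * K by positivity)
  simp only [L]
  linarith

end AnisoOp

namespace AnisoOp

variable (P : AnisoOp)

/-- Maximum principle for the antisymmetric increments of `u` in the last direction, with the
barrier `2 A ‖x‖² / R² + K τ (2 R - τ)`. -/
theorem increment_le {u f : P.Space → ℝ} {D : ℝ}
    (hD : ∀ i, KernelBound (P.N i) D) (hD0 : 0 ≤ D) {lo hi : ℝ} (hlo : lo ≤ P.aLast)
    (hhi0 : 0 ≤ hi) (hhi : ∀ i, P.a i ≤ hi) {R A K O : ℝ} (hR : 1 ≤ R) (hA0 : 0 ≤ A)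
    (hu : P.IsSolutionIn u f (Metric.ball 0 (2 * R)))
    (hA : ∀ z, ‖z‖ < 6 * R → |u z| ≤ A) (hT : P.tail u R ≠ ⊤) (hKA : 2 * A ≤ K * R ^ 2)
    {d : P.Space} (hd : d = P.eLast ∨ d = -P.eLast)
    (hO : ∀ x ∈ Metric.ball (0 : P.Space) R, ∀ τ ∈ Ioo 0 R, f (x + τ • d) - f (x - τ • d) ≤ O)
    (hK : O + P.dim * hi * ((32 * D + 2 * P.dim) *
        (2 * A * R ^ (-(2 * P.sMin)) + (P.tail u R).toReal)) < 2 * K * lo)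
    {τ : ℝ} (hτ : τ ∈ Icc 0 R) :
    u (τ • d) - u (-(τ • d)) ≤ K * (τ * (2 * R - τ)) := by
  have hR0 : 0 < R := by linarith
  have hK0 : 0 ≤ K := by
    by_contra! h
    nlinarith [mul_neg_of_neg_of_pos h (pow_pos hR0 2)]
  have hdn : ‖d‖ = 1 := by
    rcases hd with rfl | rfl
    · exact P.norm_e _
    · rw [norm_neg]; exact P.norm_e _
  have hcont := hu.1
  set W : P.Space × ℝ → ℝ := fun w ↦ u (w.1 + w.2 • d) - u (w.1 - w.2 • d) -
    (2 * A / R ^ 2 * ‖w.1‖ ^ 2 + K * (w.2 * (2 * R - w.2))) with hW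
  have hWc : Continuous W := by fun_prop
  obtain ⟨⟨x₀, τ₀⟩, ⟨hx₀, hτ₀⟩, hmax⟩ :=
    ((isCompact_closedBall (0 : P.Space) R).prod (isCompact_Icc (a := (0 : ℝ)) (b := R))).exists_isMaxOn
      ⟨(0, 0), by simp [hR0.le]⟩ hWc.continuousOn
  replace hx₀ : ‖x₀‖ ≤ R := by simpa using hx₀
  replace hτ₀ : 0 ≤ τ₀ ∧ τ₀ ≤ R := hτ₀
  replace hmax : ∀ x σ, ‖x‖ ≤ R → 0 ≤ σ → σ ≤ R → W (x, σ) ≤ W (x₀, τ₀) := fun x σ h1 h2 h3 ↦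
    hmax (show (x, σ) ∈ _ from ⟨by simpa using h1, h2, h3⟩)
  suffices hneg : W (x₀, τ₀) ≤ 0 by
    have h := (hmax 0 τ (by simpa using hR0.le) hτ.1 hτ.2).trans hneg
    simp only [hW, zero_add, zero_sub, norm_zero] at h
    linarith
  by_contra! hpos
  have hnorm : ∀ x : P.Space, ∀ σ : ℝ, 0 ≤ σ → ‖x + σ • d‖ ≤ ‖x‖ + σ ∧ ‖x - σ • d‖ ≤ ‖x‖ + σ := by
    intro x σ hσ
    have e : ‖σ • d‖ = σ := by rw [norm_smul, hdn, mul_one, Real.norm_of_nonneg hσ]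
    exact ⟨(norm_add_le _ _).trans_eq (by rw [e]), (norm_sub_le _ _).trans_eq (by rw [e])⟩
  have hv : ∀ x : P.Space, ∀ σ : ℝ, ‖x‖ < 5 * R → 0 ≤ σ → σ ≤ R →
      u (x + σ • d) - u (x - σ • d) ≤ 2 * A := by
    intro x σ hx h1 h2
    have a1 := hA (x + σ • d) (by linarith [(hnorm x σ h1).1])
    have a2 := hA (x - σ • d) (by linarith [(hnorm x σ h1).2])
    linarith [(abs_le.1 a1).2, (abs_le.1 a2).1]
  have hWout : ∀ x : P.Space, ∀ σ : ℝ, R ≤ ‖x‖ → ‖x‖ < 5 * R → 0 ≤ σ → σ ≤ R → W (x, σ) ≤ 0 := by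
    intro x σ h1 h2 h3 h4
    have b1 := hv x σ h2 h3 h4
    have b2 : 2 * A ≤ 2 * A / R ^ 2 * ‖x‖ ^ 2 := by
      calc 2 * A = 2 * A / R ^ 2 * R ^ 2 := by field_simp
        _ ≤ _ := by gcongr
    have b3 : 0 ≤ K * (σ * (2 * R - σ)) :=
      mul_nonneg hK0 (mul_nonneg h3 (by linarith))
    simp only [hW]
    linarith
  have hx₀R : ‖x₀‖ < R := by
    by_contra! h
    exact absurd (hWout x₀ τ₀ h (by linarith) hτ₀.1 hτ₀.2) (not_le.2 hpos)
  have hquad : 0 ≤ 2 * A / R ^ 2 * ‖x₀‖ ^ 2 := by positivity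
  have hτpos : 0 < τ₀ := by
    refine lt_of_le_of_ne hτ₀.1 fun h ↦ absurd hpos (not_lt.2 ?_)
    simp only [hW, ← h, zero_smul, add_zero, sub_zero, zero_mul, mul_zero]
    linarith
  have hτlt : τ₀ < R := by
    refine lt_of_le_of_ne hτ₀.2 fun h ↦ absurd hpos (not_lt.2 ?_)
    have b1 := hv x₀ τ₀ (by linarith) hτ₀.1 hτ₀.2
    have b2 : K * (τ₀ * (2 * R - τ₀)) = K * R ^ 2 := by rw [h]; ring
    simp only [hW]
    linarith
  have hWz : ∀ z, ‖z‖ < 4 * R → W (x₀ + z, τ₀) ≤ W (x₀, τ₀) := by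
    intro z hz
    rcases le_or_gt ‖x₀ + z‖ R with h | h
    · exact hmax _ _ h hτ₀.1 hτ₀.2
    · exact (hWout _ _ h.le (by linarith [norm_add_le x₀ z]) hτ₀.1 hτ₀.2).trans hpos.le
  set p := x₀ + τ₀ • d with hp
  set q := x₀ - τ₀ • d with hq
  have hpn : ‖p‖ < 2 * R := by linarith [(hnorm x₀ τ₀ hτ₀.1).1]
  have hqn : ‖q‖ < 2 * R := by linarith [(hnorm x₀ τ₀ hτ₀.1).2]
  obtain ⟨hpc, hpL⟩ := hu.2 p (by simpa using hpn)
  obtain ⟨hqc, hqL⟩ := hu.2 q (by simpa using hqn)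
  have hpq : u q ≤ u p := by
    have b3 : 0 ≤ K * (τ₀ * (2 * R - τ₀)) :=
      mul_nonneg hK0 (mul_nonneg hτ₀.1 (by linarith))
    simp only [hW] at hpos
    linarith
  have hS : ∀ z, ‖z‖ < 4 * R →
      P.incr₂ u p z - P.incr₂ u q z ≤ 2 * (2 * A / R ^ 2) * ‖z‖ ^ 2 := by
    intro z hz
    have h1 := hWz z hz
    have h2 := hWz (-z) (by rwa [norm_neg])
    have hpar := parallelogram_law_with_norm ℝ x₀ z
    simp only [hW] at h1 h2
    rw [← sub_eq_add_neg] at h2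
    rw [show x₀ + z + τ₀ • d = p + z by rw [hp]; abel,
      show x₀ + z - τ₀ • d = q + z by rw [hq]; abel] at h1
    rw [show x₀ - z + τ₀ • d = p - z by rw [hp]; abel,
      show x₀ - z - τ₀ • d = q - z by rw [hq]; abel] at h2
    have hpar' := congrArg (fun y ↦ 2 * A / R ^ 2 * y) hpar
    simp only [incr₂]
    linarith
  have hlast : ∀ᶠ r in nhds (0 : ℝ),
      P.incr₂ u p (r • P.eLast) - P.incr₂ u q (r • P.eLast) ≤ -(2 * K) * r ^ 2 := by
    filter_upwards [Metric.ball_mem_nhds (0 : ℝ) (lt_min hτpos (sub_pos.2 hτlt))] with r hr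
    have hr' : |r| < min τ₀ (R - τ₀) := by simpa using hr
    obtain ⟨hr1, hr2⟩ := lt_min_iff.1 hr'
    obtain ⟨l1, l2⟩ := abs_lt.1 hr1
    obtain ⟨l3, l4⟩ := abs_lt.1 hr2
    have h1 := hmax x₀ (τ₀ + r) hx₀ (by linarith) (by linarith)
    have h2 := hmax x₀ (τ₀ - r) hx₀ (by linarith) (by linarith)
    simp only [hW, add_smul, sub_smul] at h1 h2
    rw [show x₀ + (τ₀ • d + r • d) = p + r • d by rw [hp]; abel,
      show x₀ - (τ₀ • d + r • d) = q - r • d by rw [hq]; abel] at h1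
    rw [show x₀ + (τ₀ • d - r • d) = p - r • d by rw [hp]; abel,
      show x₀ - (τ₀ • d - r • d) = q + r • d by rw [hq]; abel] at h2
    have hsym : P.incr₂ u p (r • P.eLast) - P.incr₂ u q (r • P.eLast) =
        P.incr₂ u p (r • d) - P.incr₂ u q (r • d) := by
      rcases hd with rfl | rfl
      · rfl
      · simp only [incr₂, smul_neg, sub_neg_eq_add, ← sub_eq_add_neg]; ring
    rw [hsym]
    simp only [incr₂]
    nlinarith [h1, h2]
  have hmain := P.L_sub_ge hcont hD hD0 hlo hhi0 hhi hR (M := 2 * A) (by positivity) hK0 hpc hqc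
    hpn hqn hpq hS hlast hT
  rw [hpL, hqL] at hmain
  have := hO x₀ (by simpa using hx₀R) τ₀ ⟨hτpos, hτlt⟩
  linarith

theorem abs_increment_le {u f : P.Space → ℝ} {D : ℝ}
    (hD : ∀ i, KernelBound (P.N i) D) (hD0 : 0 ≤ D) {lo hi : ℝ} (hlo0 : 0 < lo)
    (hlo : lo ≤ P.aLast) (hhi0 : 0 ≤ hi) (hhi : ∀ i, P.a i ≤ hi) {R A O : ℝ} (hR : 1 ≤ R)
    (hA0 : 0 ≤ A) (hu : P.IsSolutionIn u f (Metric.ball 0 (2 * R)))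
    (hA : ∀ z, ‖z‖ < 6 * R → |u z| ≤ A) (hT : P.tail u R ≠ ⊤)
    (hO : ∀ x ∈ Metric.ball (0 : P.Space) R, ∀ τ ∈ Ioo 0 R,
      |f (x + τ • P.eLast) - f (x - τ • P.eLast)| ≤ O)
    {t : ℝ} (ht : |t| < R) :
    |u (t • P.eLast) - u (-t • P.eLast)| ≤
      (1 / lo * (O + P.dim * hi * ((32 * D + 2 * P.dim) *
        (2 * A * R ^ (-(2 * P.sMin)) + (P.tail u R).toReal))) +
          4 * (A * R ^ (-(2 * P.sMin)))) * (R * |t|) := by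
  have hR0 : 0 < R := by linarith
  set Q := R ^ (-(2 * P.sMin)) with hQdef
  have hR2 : 1 / R ^ 2 ≤ Q := by
    refine le_trans (le_of_eq ?_)
      (Real.rpow_le_rpow_of_exponent_le hR (show -2 ≤ -(2 * P.sMin) by linarith [P.sMin_le_one]))
    rw [Real.rpow_neg hR0.le, one_div]
    norm_cast
  set B := O + P.dim * hi * ((32 * D + 2 * P.dim) * (2 * A * Q + (P.tail u R).toReal)) with hB
  have key : ∀ δ : ℝ, 0 < δ → ∀ d : P.Space, (d = P.eLast ∨ d = -P.eLast) →
      ∀ τ ∈ Icc 0 R, u (τ • d) - u (-(τ • d)) ≤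
        (1 / lo * B + 4 * (A * Q) + δ) * (R * τ) := by
    intro δ hδ d hd τ hτ
    have hO0 : 0 ≤ O := (abs_nonneg _).trans (hO 0 (by simpa using hR0) (R / 2)
      ⟨by linarith, by linarith⟩)
    have hB0 : 0 ≤ B := by positivity
    have h1 := P.increment_le (O := O) (K := 1 / (2 * lo) * B + 2 * (A * Q) + δ / 2) hD hD0 hlo hhi0
      hhi hR hA0 hu hA hT ?_ hd ?_ ?_ hτ
    · have hK0 : 0 ≤ 1 / (2 * lo) * B + 2 * (A * Q) + δ / 2 := by positivity
      have h2 : τ * (2 * R - τ) ≤ 2 * (R * τ) := by nlinarith [sq_nonneg τ]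
      refine (h1.trans (mul_le_mul_of_nonneg_left h2 hK0)).trans (le_of_eq ?_)
      field_simp
      ring
    · have h3 : 2 * A ≤ 2 * (A * Q) * R ^ 2 := by
        calc 2 * A = 2 * (A * (1 / R ^ 2)) * R ^ 2 := by field_simp
          _ ≤ _ := by gcongr
      have h4 : 0 ≤ (1 / (2 * lo) * B + δ / 2) * R ^ 2 := by positivity
      linarith
    · intro x hx σ hσ
      rcases hd with rfl | rfl
      · exact (le_abs_self _).trans (hO x hx σ hσ)
      · rw [smul_neg, sub_neg_eq_add, ← sub_eq_add_neg]
        exact (le_abs_self _).trans ((abs_sub_comm _ _).trans_le (hO x hx σ hσ))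
    · rw [← hB]
      have e : 2 * (1 / (2 * lo) * B + 2 * (A * Q) + δ / 2) * lo =
          B + (4 * (A * Q) + δ) * lo := by field_simp; ring
      rw [e]
      have : 0 < (4 * (A * Q) + δ) * lo := by positivity
      linarith
  have key' : ∀ d : P.Space, (d = P.eLast ∨ d = -P.eLast) →
      ∀ τ ∈ Icc 0 R, u (τ • d) - u (-(τ • d)) ≤ (1 / lo * B + 4 * (A * Q)) * (R * τ) := by
    intro d hd τ hτ
    have hτ0 : 0 ≤ R * τ := mul_nonneg hR0.le hτ.1
    refine le_of_forall_pos_le_add fun ε hε ↦ ?_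
    refine (key (ε / (R * τ + 1)) (by positivity) d hd τ hτ).trans ?_
    rw [add_mul]
    gcongr
    rw [div_mul_eq_mul_div, div_le_iff₀ (by positivity)]
    linarith
  have h1 := key' P.eLast (Or.inl rfl) |t| ⟨abs_nonneg _, ht.le⟩
  have h2 := key' (-P.eLast) (Or.inr rfl) |t| ⟨abs_nonneg _, ht.le⟩
  rw [smul_neg, neg_neg] at h2
  rw [abs_le]
  rcases abs_choice t with h | h <;> rw [h] at h1 h2 ⊢ <;>
    simp only [neg_smul, neg_neg] at h1 h2 ⊢ <;> constructor <;> linarith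

end AnisoOp

theorem theorem4p3 (n : ℕ) (smin smax lo hi : ℝ) (hlo : 0 < lo) :
    ∃ C : ℝ, 0 < C ∧
      ∀ P : AnisoOp, P.dim = n → P.sMin = smin → P.sMax = smax →
        lo ≤ P.aLast → P.aLast ≤ hi → (∀ i, P.a i ≤ hi) →
      ∀ R : ℝ, 1 ≤ R →
      ∀ u f : P.Space → ℝ,
        P.IsSolutionIn u f (Metric.ball 0 (6 * Real.sqrt n * R)) →
      ∀ t ∈ Set.Ioo (-(R / (6 * Real.sqrt n))) (R / (6 * Real.sqrt n)), t ≠ 0 →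
        ENNReal.ofReal (|u (t • P.eLast) - u (-t • P.eLast)| / |t|) ≤
          ENNReal.ofReal C *
            (ENNReal.ofReal R * P.oscLast f R
              + ENNReal.ofReal R * P.normLinf u (Metric.ball 0 (6 * R)) /
                  ENNReal.ofReal (R ^ (2 * P.sMin))
              + ENNReal.ofReal R * P.tail u R) := by
  have hex : ∀ N : ℕ, ∃ D, 0 ≤ D ∧ (1 ≤ N → KernelBound N D) := fun N ↦ by
    by_cases hN : 1 ≤ N
    · obtain ⟨D, hD⟩ := exists_kernelBound hN
      exact ⟨D, hD.1, fun _ ↦ hD⟩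
    · exact ⟨0, le_rfl, fun h ↦ absurd h hN⟩
  choose D' hD'0 hD' using hex
  set D := ∑ N ∈ Finset.range (n + 1), D' N with hDdef
  have hD0 : 0 ≤ D := Finset.sum_nonneg fun N _ ↦ hD'0 N
  set Γ : ℝ := n * |hi| * (32 * D + 2 * n) with hΓ
  have hΓ0 : 0 ≤ Γ := by positivity
  refine ⟨1 / lo * (1 + 2 * Γ) + 4, by positivity, ?_⟩
  intro P hn _ _ hloP hhiP hhi R hR u f hu t ht ht0
  set C : ℝ := 1 / lo * (1 + 2 * Γ) + 4 with hC
  have hC0 : 0 < C := by positivity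
  have hR0 : 0 < R := by linarith
  have hhi0 : 0 ≤ hi := P.aLast_pos.le.trans hhiP
  have hsqrt : 1 ≤ Real.sqrt n := by
    rw [Real.one_le_sqrt, ← hn]
    exact_mod_cast Nat.succ_le_succ (Nat.zero_le _)
  have hD : ∀ i, KernelBound (P.N i) D := fun i ↦
    (hD' _ (P.N_pos i)).mono (Finset.single_le_sum (f := D') (fun N _ ↦ hD'0 N)
      (Finset.mem_range.2 (Nat.lt_succ_of_le (hn ▸ P.N_le_dim i))))
  have hRpos : ENNReal.ofReal R ≠ 0 := by simpa using hR0
  have hCpos : ENNReal.ofReal C ≠ 0 := by simpa using hC0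
  by_cases hO : P.oscLast f R = ⊤
  · simp [hO, ENNReal.mul_top, hRpos, hCpos]
  by_cases hA : P.normLinf u (Metric.ball 0 (6 * R)) = ⊤
  · simp [hA, ENNReal.mul_top, hRpos, hCpos, ENNReal.top_div]
  by_cases hT : P.tail u R = ⊤
  · simp [hT, ENNReal.mul_top, hRpos, hCpos]
  set O := (P.oscLast f R).toReal with hOdef
  set A := (P.normLinf u (Metric.ball 0 (6 * R))).toReal with hAdef
  have hO0 : 0 ≤ O := ENNReal.toReal_nonneg
  have hA0 : 0 ≤ A := ENNReal.toReal_nonneg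
  have hT0 : 0 ≤ (P.tail u R).toReal := ENNReal.toReal_nonneg
  have hsol : P.IsSolutionIn u f (Metric.ball 0 (2 * R)) :=
    ⟨hu.1, fun x hx ↦ hu.2 x (Metric.ball_subset_ball (by nlinarith) hx)⟩
  have hAb : ∀ z, ‖z‖ < 6 * R → |u z| ≤ A := by
    intro z hz
    have := enorm_le_eLpNorm_top (μ := volume) hu.1 Metric.isOpen_ball subset_rfl
      (show z ∈ Metric.ball (0 : P.Space) (6 * R) by simpa using hz)
    rw [Real.enorm_eq_ofReal_abs] at this
    exact (ENNReal.ofReal_le_iff_le_toReal hA).1 this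
  have hOb : ∀ x ∈ Metric.ball (0 : P.Space) R, ∀ τ ∈ Ioo 0 R,
      |f (x + τ • P.eLast) - f (x - τ • P.eLast)| ≤ O := by
    intro x hx τ hτ
    refine (ENNReal.ofReal_le_iff_le_toReal hO).1 ?_
    unfold AnisoOp.oscLast
    exact le_iSup₂_of_le x hx (le_iSup₂_of_le τ hτ le_rfl)
  have htR : |t| < R := by
    refine (abs_lt.2 ht).trans_le (div_le_self hR0.le (by linarith))
  have hmain := P.abs_increment_le hD hD0 hlo hloP hhi0 hhi hR hA0 hsol hAb hT hOb htR
  set Q := R ^ (-(2 * P.sMin)) with hQ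
  have hQ0 : 0 < Q := Real.rpow_pos_of_pos hR0 _
  have ht' : 0 < |t| := abs_pos.2 ht0
  have hreal : |u (t • P.eLast) - u (-t • P.eLast)| / |t| ≤
      C * (R * O + R * A / R ^ (2 * P.sMin) + R * (P.tail u R).toReal) := by
    rw [div_le_iff₀ ht']
    refine hmain.trans ?_
    have hAQ : R * A / R ^ (2 * P.sMin) = R * (A * Q) := by
      rw [hQ, Real.rpow_neg hR0.le]; ring
    rw [hAQ, hn]
    have hΓ' : (n : ℝ) * hi * ((32 * D + 2 * n) * (2 * A * Q + (P.tail u R).toReal)) =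
        Γ * (2 * (A * Q) + (P.tail u R).toReal) := by
      rw [hΓ, abs_of_nonneg hhi0]; ring
    rw [hΓ']
    have hX : 0 ≤ A * Q := by positivity
    set X := A * Q
    set T := (P.tail u R).toReal
    have hl : 0 < 1 / lo := by positivity
    have h1 : 1 / lo * (O + Γ * (2 * X + T)) + 4 * X ≤ C * (O + X + T) := by
      have e : C * (O + X + T) - (1 / lo * (O + Γ * (2 * X + T)) + 4 * X) =
          1 / lo * (X + T + Γ * (2 * O + T)) + 4 * (O + T) := by rw [hC]; ring
      have : 0 ≤ 1 / lo * (X + T + Γ * (2 * O + T)) + 4 * (O + T) := by positivity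
      linarith
    calc _ ≤ C * (O + X + T) * (R * |t|) := by gcongr
      _ = _ := by ring
  refine (ENNReal.ofReal_le_ofReal hreal).trans (le_of_eq ?_)
  have hp : 0 < R ^ (2 * P.sMin) := Real.rpow_pos_of_pos hR0 _
  clear_value C
  rw [ENNReal.ofReal_mul hC0.le, ENNReal.ofReal_add (by positivity) (by positivity),
    ENNReal.ofReal_add (by positivity) (by positivity), ENNReal.ofReal_mul hR0.le,
    ENNReal.ofReal_mul hR0.le, ENNReal.ofReal_div_of_pos hp, ENNReal.ofReal_mul hR0.le,
    ENNReal.ofReal_toReal hO, ENNReal.ofReal_toReal hA, ENNReal.ofReal_toReal hT]
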